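/- StrNim is the following two-player game. A position is a finite string over an alphabet $\Sigma$. The players move alternately; a move selects a non-empty substring that is a repetition of a single character, i.e. writes the position as $x\,d^k\,y$ with $x,y\in\Sigma^*$, $d\in\Sigma$, $k\ge 1$, and replaces it by $xy$. A player who cannot move loses. A position is a $\mathcal P$-position if the previous player (the one not about to move) wins from it; equivalently, if no move from it leads to a $\mathcal P$-position. Let $\mathcal P\subseteq\Sigma^*$ be the set of all $\mathcal P$-positions. **Theorem.** Let $\mathtt a,\mathtt b,\mathtt c\in\Sigma$ be pairwise distinct characters. Then the language $\mathcal P\cap\{\mathtt a,\mathtt b,\mathtt c\}^*$ is not context-free. -/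

import Mathlib

open scoped Computability

namespace StrNim

variable {A : Type*}

/-- A move of StrNim: a position is a string, and `Move s t` says that `t` arises from `s` by
removing a non-empty substring `c ^ k` that is a repetition of a single character `c`. -/
def Move (s t : List A) : Prop :=
  ∃ (x y : List A) (c : A) (k : ℕ), 1 ≤ k ∧ s = x ++ List.replicate k c ++ y ∧ t = x ++ y

theorem Move.length_lt {s t : List A} (h : Move s t) : t.length < s.length := by
  obtain ⟨x, y, c, k, hk, rfl, rfl⟩ := h
  simp only [List.length_append, List.length_replicate]
  omega

/-- `IsPPosition s`: the previous player wins from `s` under normal play (a player who cannot move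
loses), that is, no move from `s` leads to a position from which the previous player wins.
The recursion is on the length of the string. -/
def IsPPosition (s : List A) : Prop :=
  ∀ t : List A, Move s t → ¬ IsPPosition t
termination_by s.length
decreasing_by exact Move.length_lt ‹_›

/-- The language of all P-positions of StrNim over the alphabet `A`. -/
def pPositions (A : Type*) : Language A := {s : List A | IsPPosition s}

end StrNim

/-! On `a ^ i b ^ j c ^ k` the game is three-heap Nim, so such a word is a P-position iff `i ^^^ j
^^^ k = 0` (`isPPosition_threeBlocks_iff`). Only the downward half of the pumping lemma is needed
(`exists_pump_down`): a long word of a context-free language stays in it after deleting between 1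
and `p` letters inside some window of length at most `p`. Apply it to the heaps `2 ^ p`, `2 ^ (p +
1)`, `3 * 2 ^ p`. The window is too short to meet both outer blocks. Deleting from one block only
breaks the zero sum; if the middle block shrinks, the first two heaps have xor below `2 ^ (p + 1)`,
while the third stays above it (`xor_sub_ne_zero`). -/

/-! ### Pumping down in context-free languages. -/

namespace ContextFreeGrammar

variable {T : Type*}

/-- `g.DerivesIn n s w`: the sentential form `s` derives the word `w` by a forest of derivation
trees with `n` inner nodes. -/
inductive DerivesIn (g : ContextFreeGrammar T) : ℕ → List (Symbol T g.NT) → List T → Prop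
  | nil : DerivesIn g 0 [] []
  | terminal {n s w} (t : T) (h : DerivesIn g n s w) :
      DerivesIn g n (Symbol.terminal t :: s) (t :: w)
  | nonterminal {m n s u w} (r : ContextFreeRule T g.NT) (hr : r ∈ g.rules)
      (h₁ : DerivesIn g m r.output u) (h₂ : DerivesIn g n s w) :
      DerivesIn g (m + n + 1) (Symbol.nonterminal r.input :: s) (u ++ w)

open Classical in
/-- Like `DerivesIn`, with nonterminals from `S` only and without a nonterminal that occurs twice
on a path of a derivation tree. -/
inductive RepeatFree (g : ContextFreeGrammar T) :
    Finset g.NT → ℕ → List (Symbol T g.NT) → List T → Prop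
  | nil {S} : RepeatFree g S 0 [] []
  | terminal {S n s w} (t : T) (h : RepeatFree g S n s w) :
      RepeatFree g S n (Symbol.terminal t :: s) (t :: w)
  | nonterminal {S m n s u w} (r : ContextFreeRule T g.NT) (hr : r ∈ g.rules) (hS : r.input ∈ S)
      (h₁ : RepeatFree g (S.erase r.input) m r.output u) (h₂ : RepeatFree g S n s w) :
      RepeatFree g S (m + n + 1) (Symbol.nonterminal r.input :: s) (u ++ w)

variable {g : ContextFreeGrammar T}

lemma RepeatFree.derivesIn {S : Finset g.NT} {n : ℕ} {s : List (Symbol T g.NT)} {w : List T}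
    (h : g.RepeatFree S n s w) : g.DerivesIn n s w := by
  induction h with
  | nil => exact .nil
  | terminal t _ ih => exact .terminal t ih
  | nonterminal r hr _ _ _ ih₁ ih₂ => exact .nonterminal r hr ih₁ ih₂

lemma DerivesIn.append {m n : ℕ} {s t : List (Symbol T g.NT)} {u w : List T}
    (hs : g.DerivesIn m s u) (ht : g.DerivesIn n t w) : g.DerivesIn (m + n) (s ++ t) (u ++ w) := by
  induction hs with
  | nil => simpa using ht
  | terminal t _ ih => exact .terminal t ih
  | @nonterminal m k s u v r hr h₁ _ _ ih₂ =>
    have := DerivesIn.nonterminal r hr h₁ ih₂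
    rw [List.append_assoc, List.cons_append]
    convert this using 1
    omega

lemma DerivesIn.of_append {n : ℕ} {s t : List (Symbol T g.NT)} {w : List T}
    (h : g.DerivesIn n (s ++ t) w) :
    ∃ k l u v, w = u ++ v ∧ g.DerivesIn k s u ∧ g.DerivesIn l t v := by
  generalize hst : s ++ t = st at h
  induction h generalizing s with
  | nil =>
    obtain ⟨rfl, rfl⟩ := List.append_eq_nil_iff.1 hst
    exact ⟨0, 0, [], [], rfl, .nil, .nil⟩
  | @terminal n s' w x h ih =>
    cases s with
    | nil => subst hst; exact ⟨0, n, [], _, rfl, .nil, .terminal x h⟩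
    | cons y s =>
      obtain ⟨rfl, hs⟩ := List.cons.inj hst
      obtain ⟨k, l, u, v, rfl, hu, hv⟩ := ih hs
      exact ⟨k, l, x :: u, v, rfl, .terminal x hu, hv⟩
  | @nonterminal m n s' u₀ w r hr h₁ h₂ _ ih =>
    cases s with
    | nil => subst hst; exact ⟨0, _, [], _, rfl, .nil, .nonterminal r hr h₁ h₂⟩
    | cons y s =>
      obtain ⟨rfl, hs⟩ := List.cons.inj hst
      obtain ⟨k, l, u, v, rfl, hu, hv⟩ := ih hs
      exact ⟨_, l, u₀ ++ u, v, by simp, .nonterminal r hr h₁ hu, hv⟩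

lemma DerivesIn.of_rewrites {r : ContextFreeRule T g.NT} (hr : r ∈ g.rules)
    {s t : List (Symbol T g.NT)} (hst : r.Rewrites s t) {n : ℕ} {w : List T}
    (h : g.DerivesIn n t w) : ∃ m, g.DerivesIn m s w := by
  induction hst generalizing n w with
  | head s =>
    obtain ⟨k, l, u, v, rfl, hu, hv⟩ := h.of_append
    exact ⟨_, .nonterminal r hr hu hv⟩
  | cons x _ ih =>
    cases h with
    | terminal t h =>
      obtain ⟨m, hm⟩ := ih h
      exact ⟨m, .terminal t hm⟩
    | nonterminal q hq h₁ h₂ =>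
      obtain ⟨m, hm⟩ := ih h₂
      exact ⟨_, .nonterminal q hq h₁ hm⟩

lemma DerivesIn.derives {n : ℕ} {s : List (Symbol T g.NT)} {w : List T}
    (h : g.DerivesIn n s w) : g.Derives s (w.map Symbol.terminal) := by
  induction h with
  | nil => rfl
  | terminal t _ ih => exact ih.append_left [Symbol.terminal t]
  | @nonterminal m n s u w r hr _ _ ih₁ ih₂ =>
    have h₀ : g.Produces (.nonterminal r.input :: s) (r.output ++ s) := ⟨r, hr, .head s⟩
    rw [List.map_append]
    exact (h₀.trans_derives (ih₁.append_right s)).trans (ih₂.append_left _)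

lemma derives_iff_exists_derivesIn {s : List (Symbol T g.NT)} {w : List T} :
    g.Derives s (w.map Symbol.terminal) ↔ ∃ n, g.DerivesIn n s w := by
  refine ⟨fun h ↦ ?_, fun ⟨_, h⟩ ↦ h.derives⟩
  induction h using Relation.ReflTransGen.head_induction_on with
  | refl =>
    refine ⟨0, ?_⟩
    induction w with
    | nil => exact .nil
    | cons t w ih => exact .terminal t ih
  | head hst _ ih =>
    obtain ⟨r, hr, hst⟩ := hst
    obtain ⟨n, h⟩ := ih
    exact h.of_rewrites hr hst

open Classical in
-- Along a path each nonterminal of `S` is used at most once, so the trees have depth at most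
-- `S.card` and branching at most `b`.
lemma RepeatFree.length_le {b : ℕ} (hb : 1 ≤ b) (hg : ∀ r ∈ g.rules, r.output.length ≤ b)
    {S : Finset g.NT} {n : ℕ} {s : List (Symbol T g.NT)} {w : List T}
    (h : g.RepeatFree S n s w) : w.length ≤ s.length * b ^ S.card := by
  induction h with
  | nil => simp
  | @terminal S n s w t _ ih =>
    have : 1 ≤ b ^ S.card := Nat.one_le_pow _ _ hb
    simp only [List.length_cons, add_mul, one_mul]
    omega
  | @nonterminal S m n s u w r hr hS _ _ ih₁ ih₂ =>
    have h₁ : u.length ≤ b ^ S.card :=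
      calc u.length ≤ r.output.length * b ^ (S.erase r.input).card := ih₁
        _ ≤ b * b ^ (S.erase r.input).card := Nat.mul_le_mul_right _ (hg r hr)
        _ = b ^ S.card := by rw [← pow_succ', Finset.card_erase_add_one hS]
    simp only [List.length_cons, List.length_append, add_mul, one_mul]
    omega

open Classical in
lemma RepeatFree.erase_or_exists_subtree {S : Finset g.NT} {n : ℕ} {s : List (Symbol T g.NT)}
    {w : List T} (h : g.RepeatFree S n s w) (N : g.NT) :
    g.RepeatFree (S.erase N) n s w ∨
      ∃ m u v z, m ≤ n ∧ w = u ++ v ++ z ∧ g.DerivesIn m [.nonterminal N] v := by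
  induction h with
  | nil => exact .inl .nil
  | terminal t _ ih =>
    obtain ih | ⟨m, u, v, z, hm, rfl, h⟩ := ih
    · exact .inl (.terminal t ih)
    · exact .inr ⟨m, t :: u, v, z, hm, rfl, h⟩
  | @nonterminal S m n s u₀ w₀ r hr hS h₁ _ ih₁ ih₂ =>
    obtain ih₁ | ⟨k, u, v, z, hk, rfl, h⟩ := ih₁
    · obtain ih₂ | ⟨k, u, v, z, hk, rfl, h⟩ := ih₂
      · by_cases hN : r.input = N
        · subst hN
          refine .inr ⟨m + 0 + 1, [], u₀ ++ [], w₀, by omega, by simp, ?_⟩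
          exact .nonterminal r hr h₁.derivesIn .nil
        · rw [Finset.erase_right_comm] at ih₁
          exact .inl (.nonterminal r hr (Finset.mem_erase.2 ⟨hN, hS⟩) ih₁ ih₂)
      · exact .inr ⟨k, u₀ ++ u, v, z, by omega, by simp, h⟩
    · exact .inr ⟨k, u, v, z ++ w₀, by omega, by simp, h⟩

open Classical in
-- Take a lowest repetition: the forest below its upper node is repeat-free, which bounds `v ++ x ++
-- y`. Replacing the upper subtree by the lower one deletes `v` and `y` and lowers the node count.
lemma DerivesIn.repeatFree_or_exists_smaller {b : ℕ} (hb : 1 ≤ b)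
    (hg : ∀ r ∈ g.rules, r.output.length ≤ b) {n : ℕ} {s : List (Symbol T g.NT)} {w : List T}
    (h : g.DerivesIn n s w) :
    g.RepeatFree (g.rules.image ContextFreeRule.input) n s w ∨
      ∃ m u v x y z, m < n ∧ w = u ++ (v ++ x ++ y) ++ z ∧
        (v ++ x ++ y).length ≤ b * b ^ (g.rules.image ContextFreeRule.input).card ∧
        g.DerivesIn m s (u ++ x ++ z) := by
  induction h with
  | nil => exact .inl .nil
  | terminal t _ ih =>
    obtain ih | ⟨m, u, v, x, y, z, hm, rfl, hl, h⟩ := ih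
    · exact .inl (.terminal t ih)
    · exact .inr ⟨m, t :: u, v, x, y, z, hm, rfl, hl, .terminal t h⟩
  | @nonterminal m n s u₀ w₀ r hr h₁ h₂ ih₁ ih₂ =>
    obtain ih₁ | ⟨k, u, v, x, y, z, hk, rfl, hl, h⟩ := ih₁
    · obtain ih₂ | ⟨k, u, v, x, y, z, hk, rfl, hl, h⟩ := ih₂
      · obtain h | ⟨k, u, v, z, hk, rfl, h⟩ := ih₁.erase_or_exists_subtree r.input
        · exact .inl (.nonterminal r hr (Finset.mem_image_of_mem _ hr) h ih₂)
        · refine .inr ⟨k + n, [], u, v, z, w₀, by omega, by simp, ?_, ?_⟩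
          · exact (ih₁.length_le hb hg).trans (Nat.mul_le_mul_right _ (hg r hr))
          · exact h.append h₂
      · refine .inr ⟨m + k + 1, u₀ ++ u, v, x, y, z, by omega, by simp, hl, ?_⟩
        simpa using DerivesIn.nonterminal r hr h₁ h
    · refine .inr ⟨k + n + 1, u, v, x, y, z ++ w₀, by omega, by simp, hl, ?_⟩
      simpa using DerivesIn.nonterminal r hr h h₂

lemma exists_pump_down (g : ContextFreeGrammar T) :
    ∃ p : ℕ, ∀ w ∈ g.language, p < w.length →
      ∃ u v x y z, w = u ++ (v ++ x ++ y) ++ z ∧ (v ++ x ++ y).length ≤ p ∧ v ++ y ≠ [] ∧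
        u ++ x ++ z ∈ g.language := by
  classical
  set b := g.rules.sup (fun r ↦ r.output.length) + 1 with hb
  have hg : ∀ r ∈ g.rules, r.output.length ≤ b := fun r hr ↦
    (Finset.le_sup (f := fun r : ContextFreeRule T g.NT ↦ r.output.length) hr).trans
      (Nat.le_succ _)
  refine ⟨b * b ^ (g.rules.image ContextFreeRule.input).card, fun w hw hlen ↦ ?_⟩
  obtain ⟨n, hn⟩ := derives_iff_exists_derivesIn.1 hw
  induction n using Nat.strong_induction_on with
  | _ n ih =>
    obtain h | ⟨m, u, v, x, y, z, hm, rfl, hl, h⟩ :=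
      hn.repeatFree_or_exists_smaller (by omega) hg
    · have h₁ := h.length_le (by omega) hg
      have h₂ := Nat.mul_le_mul_right (b ^ (g.rules.image ContextFreeRule.input).card)
        (show 1 ≤ b by omega)
      simp only [List.length_singleton] at h₁
      omega
    -- If nothing was deleted, the same word has a smaller derivation; this is why nodes are
    -- counted.
    · by_cases hvy : v ++ y = []
      · obtain ⟨rfl, rfl⟩ := List.append_eq_nil_iff.1 hvy
        exact ih m hm (by simpa using h)
      · exact ⟨u, v, x, y, z, rfl, hl, hvy, h.derives⟩

end ContextFreeGrammar

theorem Language.IsContextFree.exists_pump_down {T : Type*} {L : Language T}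
    (hL : L.IsContextFree) :
    ∃ p : ℕ, ∀ w ∈ L, p < w.length →
      ∃ u v x y z, w = u ++ (v ++ x ++ y) ++ z ∧ (v ++ x ++ y).length ≤ p ∧ v ++ y ≠ [] ∧
        u ++ x ++ z ∈ L := by
  obtain ⟨g, rfl⟩ := hL
  exact g.exists_pump_down

/-! ### Three-block words as Nim positions. -/

namespace StrNim

variable {A : Type*}

/-- The word `a ^ i b ^ j c ^ k`. -/
def threeBlocks (a b c : A) (i j k : ℕ) : List A :=
  List.replicate i a ++ List.replicate j b ++ List.replicate k c

section Blocks

variable {a b c : A}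

lemma exists_eq_threeBlocks_of_sublist {i j k : ℕ} {t : List A}
    (h : t.Sublist (threeBlocks a b c i j k)) : ∃ i' j' k', t = threeBlocks a b c i' j' k' := by
  obtain ⟨t', t₃, rfl, h', h₃⟩ := List.sublist_append_iff.1 h
  obtain ⟨t₁, t₂, rfl, h₁, h₂⟩ := List.sublist_append_iff.1 h'
  obtain ⟨i', -, rfl⟩ := List.sublist_replicate_iff.1 h₁
  obtain ⟨j', -, rfl⟩ := List.sublist_replicate_iff.1 h₂
  obtain ⟨k', -, rfl⟩ := List.sublist_replicate_iff.1 h₃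
  exact ⟨i', j', k', rfl⟩

lemma mem_threeBlocks {d : A} {i j k : ℕ} (h : d ∈ threeBlocks a b c i j k) :
    d = a ∨ d = b ∨ d = c := by
  simp only [threeBlocks, List.mem_append, List.mem_replicate] at h
  tauto

lemma count_threeBlocks [DecidableEq A] (hab : a ≠ b) (hac : a ≠ c) (hbc : b ≠ c) (i j k : ℕ) :
    (threeBlocks a b c i j k).count a = i ∧ (threeBlocks a b c i j k).count b = j ∧
      (threeBlocks a b c i j k).count c = k := by
  simp [threeBlocks, List.count_replicate, hab, hac, hbc, hab.symm, hac.symm, hbc.symm]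

lemma threeBlocks_mem_kstar (a b c : A) (i j k : ℕ) :
    threeBlocks a b c i j k ∈ ({[a], [b], [c]} : Language A)∗ := by
  refine Language.mem_kstar.2 ⟨(threeBlocks a b c i j k).map fun d ↦ [d], ?_, fun y hy ↦ ?_⟩
  · induction threeBlocks a b c i j k with
    | nil => rfl
    | cons d s ih => simpa using ih
  · obtain ⟨d, hd, rfl⟩ := List.mem_map.1 hy
    obtain rfl | rfl | rfl := mem_threeBlocks hd
    · exact Or.inl rfl
    · exact Or.inr (Or.inl rfl)
    · exact Or.inr (Or.inr rfl)

lemma move_threeBlocks_left {i i' : ℕ} (h : i' < i) (j k : ℕ) :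
    Move (threeBlocks a b c i j k) (threeBlocks a b c i' j k) := by
  refine ⟨List.replicate i' a, List.replicate j b ++ List.replicate k c, a, i - i', by omega,
    ?_, by simp [threeBlocks]⟩
  rw [← List.replicate_add, Nat.add_sub_cancel' h.le, threeBlocks, List.append_assoc]

lemma move_threeBlocks_middle {j j' : ℕ} (h : j' < j) (i k : ℕ) :
    Move (threeBlocks a b c i j k) (threeBlocks a b c i j' k) := by
  refine ⟨List.replicate i a ++ List.replicate j' b, List.replicate k c, b, j - j', by omega,
    ?_, by simp [threeBlocks]⟩
  rw [List.append_assoc _ _ (List.replicate (j - j') b), ← List.replicate_add,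
    Nat.add_sub_cancel' h.le, threeBlocks]

lemma move_threeBlocks_right {k k' : ℕ} (h : k' < k) (i j : ℕ) :
    Move (threeBlocks a b c i j k) (threeBlocks a b c i j k') := by
  refine ⟨threeBlocks a b c i j k', [], c, k - k', by omega, ?_, by simp⟩
  rw [List.append_nil, threeBlocks, threeBlocks,
    List.append_assoc _ _ (List.replicate (k - k') c), ← List.replicate_add,
    Nat.add_sub_cancel' h.le]

/-- A sublist of a three-block word is again one, its exponents are its letter counts, and a move
lowers the count of a single letter. -/
lemma Move.exists_eq_threeBlocks (hab : a ≠ b) (hac : a ≠ c) (hbc : b ≠ c) {i j k : ℕ}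
    {t : List A} (h : Move (threeBlocks a b c i j k) t) :
    ∃ i' j' k', t = threeBlocks a b c i' j' k' ∧
      ((i' < i ∧ j' = j ∧ k' = k) ∨ (i' = i ∧ j' < j ∧ k' = k) ∨ (i' = i ∧ j' = j ∧ k' < k)) := by
  classical
  obtain ⟨x, y, d, n, hn, hs, rfl⟩ := h
  have hd : d = a ∨ d = b ∨ d = c :=
    mem_threeBlocks (i := i) (j := j) (k := k) (by
      rw [hs]
      exact List.mem_append_left _ (List.mem_append_right _ (List.mem_replicate.2 ⟨by omega, rfl⟩)))
  have hsub : (x ++ y).Sublist (threeBlocks a b c i j k) := by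
    rw [hs]; simp
  obtain ⟨i', j', k', ht⟩ := exists_eq_threeBlocks_of_sublist hsub
  refine ⟨i', j', k', ht, ?_⟩
  have hcount (e : A) : (threeBlocks a b c i j k).count e =
      (threeBlocks a b c i' j' k').count e + (List.replicate n d).count e := by
    rw [hs, ← ht]; simp only [List.count_append]; omega
  obtain ⟨ha, hb, hc⟩ := count_threeBlocks hab hac hbc i j k
  obtain ⟨ha', hb', hc'⟩ := count_threeBlocks hab hac hbc i' j' k'
  have h₁ := hcount a
  have h₂ := hcount b
  have h₃ := hcount c
  rw [ha, ha'] at h₁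
  rw [hb, hb'] at h₂
  rw [hc, hc'] at h₃
  obtain rfl | rfl | rfl := hd
  all_goals
    simp [List.count_replicate, hab, hac, hbc, hab.symm, hac.symm, hbc.symm] at h₁ h₂ h₃
    omega

/-- On the words `a ^ i b ^ j c ^ k`, StrNim is Nim with three heaps. -/
theorem isPPosition_threeBlocks_iff (hab : a ≠ b) (hac : a ≠ c) (hbc : b ≠ c) (i j k : ℕ) :
    IsPPosition (threeBlocks a b c i j k) ↔ i ^^^ j ^^^ k = 0 := by
  induction hn : i + j + k using Nat.strong_induction_on generalizing i j k with
  | _ n ih =>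
    subst hn
    rw [IsPPosition]
    constructor
    · intro h
      by_contra hne
      -- The winning Nim move: some heap exceeds the xor of the other two and is reduced to it.
      obtain hi | hj | hk := Nat.xor_trichotomy hne
      · refine h _ (move_threeBlocks_left hi j k) ((ih _ (by omega) _ _ _ rfl).2 ?_)
        rw [Nat.xor_assoc, Nat.xor_self]
      · refine h _ (move_threeBlocks_middle hj i k) ((ih _ (by omega) _ _ _ rfl).2 ?_)
        rw [Nat.xor_comm k i, ← Nat.xor_assoc, Nat.xor_self, Nat.zero_xor, Nat.xor_self]
      · refine h _ (move_threeBlocks_right hk i j) ((ih _ (by omega) _ _ _ rfl).2 ?_)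
        rw [Nat.xor_self]
    · intro h t ht hP
      obtain ⟨i', j', k', rfl, hlt⟩ := ht.exists_eq_threeBlocks hab hac hbc
      have h' := (ih _ (by omega) i' j' k' rfl).1 hP
      obtain ⟨hi, rfl, rfl⟩ | ⟨rfl, hj, rfl⟩ | ⟨rfl, rfl, hk⟩ := hlt
      · rw [← h', Nat.xor_left_inj, Nat.xor_left_inj] at h
        omega
      · rw [← h', Nat.xor_left_inj, Nat.xor_right_inj] at h
        omega
      · rw [← h', Nat.xor_right_inj] at h
        omega

lemma notMem_or_notMem_of_infix_threeBlocks (hab : a ≠ b) (hac : a ≠ c) (hbc : b ≠ c) {i j k : ℕ}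
    {u q z : List A} (h : threeBlocks a b c i j k = u ++ q ++ z) (hq : q.length < j) :
    a ∉ q ∨ c ∉ q := by
  rw [threeBlocks, List.append_eq_append_iff] at h
  obtain ⟨e, h, he⟩ | ⟨e, h, -⟩ := h
  · left
    rw [eq_comm, List.append_assoc, List.append_eq_append_iff] at h
    obtain ⟨f, -, h⟩ | ⟨f, -, h⟩ := h
    · intro ha
      have ha' : a ∈ List.replicate j b ++ e := by rw [h]; exact List.mem_append_right _ ha
      obtain h | h := List.mem_append.1 ha'
      · exact hab (List.mem_replicate.1 h).2
      · have : a ∈ List.replicate k c := by rw [he]; exact List.mem_append_left _ h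
        exact hac (List.mem_replicate.1 this).2
    · have := congrArg List.length h
      simp only [List.length_append, List.length_replicate] at this
      omega
  · right
    intro hc
    have : c ∈ List.replicate i a ++ List.replicate j b := by rw [h]; simp [hc]
    simp only [List.mem_append, List.mem_replicate] at this
    obtain ⟨-, h⟩ | ⟨-, h⟩ := this
    · exact hac h.symm
    · exact hbc h.symm

end Blocks

/-! ### The arithmetic of the chosen heaps and the conclusion. -/

lemma two_pow_xor_two_pow_succ (p : ℕ) : 2 ^ p ^^^ 2 ^ (p + 1) = 3 * 2 ^ p := by
  have h := Nat.shiftLeft_xor_distrib (a := 1) (b := 2) (i := p)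
  simp only [Nat.shiftLeft_eq] at h
  rw [pow_succ', ← one_mul (2 ^ p), mul_left_comm, one_mul (2 * 2 ^ p), ← h]
  rw [one_mul, show 1 ^^^ 2 = 3 from rfl]

lemma xor_sub_ne_zero {p r s t : ℕ} (hp : r + s + t ≤ p) (hpos : 0 < r + s + t)
    (hrt : r = 0 ∨ t = 0) :
    (2 ^ p - r) ^^^ (2 ^ (p + 1) - s) ^^^ (3 * 2 ^ p - t) ≠ 0 := by
  intro h
  have hlt : p < 2 ^ p := Nat.lt_two_pow_self
  have h2 : 2 ^ (p + 1) = 2 * 2 ^ p := pow_succ' 2 p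
  rw [Nat.xor_eq_zero_iff] at h
  by_cases hs : s = 0
  · subst hs
    have h3 := (two_pow_xor_two_pow_succ p).symm
    obtain rfl | rfl := hrt
    · rw [Nat.sub_zero, Nat.sub_zero, ← h3] at h
      omega
    · rw [Nat.sub_zero, Nat.sub_zero, h3, Nat.xor_left_inj] at h
      omega
  -- As `s > 0`, both heaps are below `2 ^ (p + 1)`, but `3 * 2 ^ p - t > 2 ^ (p + 1)` because `t ≤
  -- p < 2 ^ p`.
  · have := Nat.xor_lt_two_pow (x := 2 ^ p - r) (y := 2 ^ (p + 1) - s) (n := p + 1)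
      (by omega) (by omega)
    omega

end StrNim

theorem mainTheorem2 {A : Type*} (a b c : A) (hab : a ≠ b) (hac : a ≠ c) (hbc : b ≠ c) :
    ¬ (StrNim.pPositions A ⊓ ({[a], [b], [c]} : Language A)∗).IsContextFree := by
  classical
  intro hL
  obtain ⟨p, hp⟩ := hL.exists_pump_down
  have hlt : p < 2 ^ p := Nat.lt_two_pow_self
  have h2 : 2 ^ (p + 1) = 2 * 2 ^ p := pow_succ' 2 p
  have hw : StrNim.IsPPosition
      (StrNim.threeBlocks a b c (2 ^ p) (2 ^ (p + 1)) (2 ^ p ^^^ 2 ^ (p + 1))) :=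
    (StrNim.isPPosition_threeBlocks_iff hab hac hbc _ _ _).2 (Nat.xor_self _)
  rw [StrNim.two_pow_xor_two_pow_succ] at hw
  obtain ⟨u, v, x, y, z, hsplit, hlen, hne, hP, -⟩ :=
    hp _ ⟨hw, StrNim.threeBlocks_mem_kstar a b c _ _ _⟩ (by
      simp only [StrNim.threeBlocks, List.length_append, List.length_replicate]
      omega)
  have hsub : (u ++ x ++ z).Sublist
      (StrNim.threeBlocks a b c (2 ^ p) (2 ^ (p + 1)) (3 * 2 ^ p)) := by
    rw [hsplit]
    simp
  obtain ⟨i, j, k, ht⟩ := StrNim.exists_eq_threeBlocks_of_sublist hsub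
  have hcount (e : A) :
      (StrNim.threeBlocks a b c (2 ^ p) (2 ^ (p + 1)) (3 * 2 ^ p)).count e =
        (StrNim.threeBlocks a b c i j k).count e + (v ++ y).count e := by
    rw [hsplit, ← ht]
    simp only [List.count_append]
    omega
  have hlength := congrArg List.length hsplit
  have hlength' := congrArg List.length ht
  simp only [StrNim.threeBlocks, List.length_append, List.length_replicate] at hlength hlength' hlen
  have hvy : 0 < v.length + y.length := by
    rw [← List.length_append]
    exact List.length_pos_iff.2 hne
  have hmem := StrNim.notMem_or_notMem_of_infix_threeBlocks hab hac hbc hsplit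
    (by simp only [List.length_append]; omega)
  have hrt : (v ++ y).count a = 0 ∨ (v ++ y).count c = 0 := by
    simp only [List.count_eq_zero, List.mem_append] at hmem ⊢
    tauto
  obtain ⟨ha, hb, hc⟩ :=
    StrNim.count_threeBlocks hab hac hbc (2 ^ p) (2 ^ (p + 1)) (3 * 2 ^ p)
  obtain ⟨ha', hb', hc'⟩ := StrNim.count_threeBlocks hab hac hbc i j k
  have h₁ := hcount a
  have h₂ := hcount b
  have h₃ := hcount c
  rw [ha, ha'] at h₁
  rw [hb, hb'] at h₂
  rw [hc, hc'] at h₃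
  -- The three counts add up to the loss of length `v.length + y.length`, which lies between 1 and
  -- `p`.
  refine StrNim.xor_sub_ne_zero (p := p) (r := (v ++ y).count a) (s := (v ++ y).count b)
    (t := (v ++ y).count c) (by omega) (by omega) hrt ?_
  rw [show 2 ^ p - (v ++ y).count a = i by omega,
    show 2 ^ (p + 1) - (v ++ y).count b = j by omega,
    show 3 * 2 ^ p - (v ++ y).count c = k by omega]
  refine (StrNim.isPPosition_threeBlocks_iff hab hac hbc i j k).1 ?_
  rw [← ht]
  exact hP
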